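/- Define the Bernoulli numbers $B_j$ and the Euler numbers $E_j$ by $$\frac{x}{e^x-1}=\sum_{j\ge 0}B_j\frac{x^j}{j!},\qquad \sec x=\sum_{j\ge 0}(-1)^jE_{2j}\frac{x^{2j}}{(2j)!},\qquad E_{2j+1}=0\ \ (j\ge 0).$$ For positive integers $n,d$ put $$S(n,d)=\sum_{j=0}^{\lfloor (d-1)/2\rfloor}\frac{(2^{2n-2j}-1)\,B_{2n-2j}}{2^{2d-1}\,d}\binom{2d-2j-2}{d-1}\binom{2n}{2j},$$ where the terms with $j>n$ (for which $\binom{2n}{2j}=0$) are zero. Then for all positive integers $n,d$: 1. if $d\le n$, then $$S(n,d)=\frac{(-1)^{d-1}}{4^n}\sum_{\ell=0}^{n-d}\binom{n-\ell}{d}\binom{2n}{2\ell}E_{2\ell};$$ 2. if $n<d<2n$, then $S(n,d)=0$; 3. if $d\ge 2n$, then $$S(n,d)=\frac{n}{2^{2d-1}\,d}\binom{2d-2n-1}{d-1}.$$ -/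

import Mathlib

open scoped Nat

/-- The Euler numbers `E_n`, defined by the formal identity
`sec x = ∑_{j ≥ 0} (-1)^j E_{2j} x^{2j} / (2j)!` together with `E_{2j+1} = 0`.
Here `sec` is the inverse of the power series `cos` over `ℚ`. -/
noncomputable def eulerNumber (n : ℕ) : ℚ :=
  if Even n then (-1) ^ (n / 2) * (n ! : ℚ) * PowerSeries.coeff n (PowerSeries.cos ℚ)⁻¹ else 0

/-!
Put `d = D + 1`. Apart from constant factors, the left-hand side is the coefficient of `s ^ (2n)`
in the product of `s tanh s = ∑ (4 ^ m - 1) B_{2m} (2s) ^ (2m) / (2m)!` with the even part of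
`f(s) = ∑_{k ≤ D} binom(2D - k, D) (2s) ^ k / k!`, a rescaled Bessel polynomial. Since
`cosh s · (s tanh s) = s sinh s`, for every power series `f`
`s tanh s · (f(s) + f(-s)) = s (f(s) - f(-s)) + s sech s · (W(s) - W(-s))`, `W(s) = e ^ s f(-s)`
(`xTanhPowerSeries_mul_add_evalNegHom`). The first summand contributes the value in the range
`d ≥ 2n`, and nothing for `d < 2n`, because `f` has degree `D`. In the second summand,
`sech s = ∑ E_j s ^ j / j!`, and the odd coefficients of `W` have the closed form
`(2M + 1)! [s ^ (2M + 1)] W = (-4) ^ D binom(M, D)` (`coeff_exp_mul_scaledBessel_neg`); hence it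
contributes the sum over Euler numbers, which is empty for `d > n`.

The closed form is the binomial identity
`∑_{k ≤ D} (-2) ^ k binom(2M + 1, k) binom(2D - k, D) = (-4) ^ D binom(M, D)`
(`sum_neg_two_pow_mul_choose_mul_choose`). Its left-hand side is the coefficient of `x ^ D` in
`(1 - 2x) ^ (2M + 1) (1 - x) ^ (-D - 1)`; expanding `(1 - 2x) ^ 2 = 1 - 4 x (1 - x)` in powers of
`x (1 - x)`, only the `D`-th power contributes. Comparing coefficients gives one formula valid for
all `n, d ≥ 1` (`sum_bernoulli_mul_choose_eq`), of which the three cases are specializations.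
-/

/-! ### A binomial identity -/

open PowerSeries in
theorem coeff_one_sub_two_mul_X_pow (N k : ℕ) :
    coeff k ((1 - 2 * X : ℚ⟦X⟧) ^ N) = (-2) ^ k * (N.choose k : ℚ) := by
  have h : (1 - 2 * X : ℚ⟦X⟧) = rescale (-2 : ℚ) (((1 + Polynomial.X : Polynomial ℚ)) : ℚ⟦X⟧) := by
    ext n
    rcases n with _ | _ | n <;>
      simp [coeff_one, coeff_succ_mul_X, ← map_ofNat (C (R := ℚ)), coeff_C]
  rw [h, ← map_pow, ← Polynomial.coe_pow, coeff_rescale, Polynomial.coeff_coe,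
    Polynomial.coeff_one_add_X_pow]

open PowerSeries in
/-- For `r > 0` the coefficient of `x ^ r` in `(1 - 2x) / (1 - x) ^ (r + 1)` vanishes, because
`binom(2r, r) = 2 binom(2r - 1, r)`. -/
theorem coeff_one_sub_two_mul_X_mul_invOneSubPow (r : ℕ) :
    coeff r ((1 - 2 * X : ℚ⟦X⟧) * (invOneSubPow ℚ (r + 1)).val) = if r = 0 then 1 else 0 := by
  rw [invOneSubPow_val_succ_eq_mk_add_choose]
  have h : ∀ f : ℚ⟦X⟧, (1 - 2 * X) * f = f - X * (C 2 * f) := fun f => by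
    rw [map_ofNat]; ring
  rw [h]
  rcases r with _ | r
  · simp
  · rw [map_sub, coeff_succ_X_mul, coeff_C_mul, coeff_mk, coeff_mk, if_neg r.succ_ne_zero]
    have h1 : (r + 1 + (r + 1)).choose (r + 1) = 2 * (r + 1 + r).choose (r + 1) := by
      have h2 : (r + 1 + r).choose r = (r + 1 + r).choose (r + 1) :=
        Nat.choose_symm_of_eq_add (by omega)
      rw [← add_assoc, Nat.choose_succ_succ, h2]
      ring
    rw [h1]
    push_cast
    ring

open PowerSeries in
theorem sum_neg_two_pow_mul_choose_mul_choose (M D : ℕ) :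
    ∑ k ∈ Finset.range (D + 1),
      (-2 : ℚ) ^ k * ((2 * M + 1).choose k : ℚ) * ((2 * D - k).choose D : ℚ)
      = (-4) ^ D * (M.choose D : ℚ) := by
  -- The left-hand side is the coefficient of `X ^ D` in `(1 - 2 * X) ^ (2 * M + 1) * J`.
  set J : ℚ⟦X⟧ := (invOneSubPow ℚ (D + 1)).val with hJ
  have hl : coeff D ((1 - 2 * X : ℚ⟦X⟧) ^ (2 * M + 1) * J) =
      ∑ k ∈ Finset.range (D + 1),
        (-2 : ℚ) ^ k * ((2 * M + 1).choose k : ℚ) * ((2 * D - k).choose D : ℚ) := by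
    rw [coeff_mul, Finset.Nat.sum_antidiagonal_eq_sum_range_succ
      (fun a b => coeff a ((1 - 2 * X : ℚ⟦X⟧) ^ (2 * M + 1)) * coeff b J)]
    refine Finset.sum_congr rfl fun k hk => ?_
    have hk' : k ≤ D := Nat.lt_succ_iff.mp (Finset.mem_range.mp hk)
    rw [coeff_one_sub_two_mul_X_pow, hJ, invOneSubPow_val_succ_eq_mk_add_choose, coeff_mk,
      show D + (D - k) = 2 * D - k by omega]
  -- Expansion in powers of `X * (1 - X)`.
  have hexp : (1 - 2 * X : ℚ⟦X⟧) ^ (2 * M + 1) * J =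
      ∑ i ∈ Finset.range (M + 1),
        C ((-4) ^ i * (M.choose i : ℚ)) * (X ^ i * ((1 - 2 * X) * ((1 - X) ^ i * J))) := by
    have h : (1 - 2 * X : ℚ⟦X⟧) ^ (2 * M + 1) =
        (1 - 2 * X) * (-4 * (X * (1 - X)) + 1) ^ M := by
      rw [pow_succ, pow_mul, mul_comm]
      congr 2
      ring
    rw [h, add_pow, Finset.mul_sum, Finset.sum_mul]
    refine Finset.sum_congr rfl fun i _ => ?_
    simp only [map_mul, map_pow, map_neg, map_ofNat, map_natCast, mul_pow, one_pow]
    ring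
  rw [← hl, hexp, map_sum, Finset.sum_eq_single D]
  · have h := one_sub_pow_mul_invOneSubPow_val_add_eq_invOneSubPow_val ℚ 1 D
    rw [add_comm 1 D] at h
    rw [coeff_C_mul, coeff_X_pow_mul', if_pos le_rfl, h, Nat.sub_self,
      coeff_one_sub_two_mul_X_mul_invOneSubPow 0, if_pos rfl, mul_one]
  · intro i _ hi
    rw [coeff_C_mul, coeff_X_pow_mul']
    split_ifs with hiD
    · have h := one_sub_pow_mul_invOneSubPow_val_add_eq_invOneSubPow_val ℚ (D - i + 1) i
      rw [show D - i + 1 + i = D + 1 by omega] at h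
      rw [h, coeff_one_sub_two_mul_X_mul_invOneSubPow, if_neg (by omega), mul_zero]
    · rw [mul_zero]
  · intro h
    rw [Nat.choose_eq_zero_of_lt (by simpa using h), Nat.cast_zero, mul_zero, map_zero, zero_mul,
      map_zero]

/-! ### Even and odd coefficients -/

open PowerSeries in
theorem coeff_evalNegHom (f : ℚ⟦X⟧) (n : ℕ) :
    coeff n (evalNegHom f) = (-1) ^ n * coeff n f := by
  simp [evalNegHom, coeff_rescale]

theorem Finset.sum_range_two_mul_add_one {A : Type*} [AddCommMonoid A] (f : ℕ → A) (n : ℕ) :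
    ∑ i ∈ Finset.range (2 * n + 1), f i =
      ∑ j ∈ Finset.range (n + 1), f (2 * j) + ∑ j ∈ Finset.range n, f (2 * j + 1) := by
  induction n with
  | zero => simp
  | succ n ih =>
    rw [show 2 * (n + 1) + 1 = 2 * n + 1 + 1 + 1 by ring, Finset.sum_range_succ,
      Finset.sum_range_succ, ih, Finset.sum_range_succ _ (n + 1),
      Finset.sum_range_succ (fun j => f (2 * j + 1)), show 2 * (n + 1) = 2 * n + 1 + 1 by ring,
      add_right_comm, add_add_add_comm, ← add_assoc]

open PowerSeries in
theorem coeff_two_mul_mul_of_odd_coeff_eq_zero (f g : ℚ⟦X⟧)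
    (hf : ∀ j, coeff (2 * j + 1) f = 0) (n : ℕ) :
    coeff (2 * n) (f * g) =
      ∑ j ∈ Finset.range (n + 1), coeff (2 * j) f * coeff (2 * n - 2 * j) g := by
  rw [coeff_mul, Finset.Nat.sum_antidiagonal_eq_sum_range_succ
      (fun a b => coeff a f * coeff b g), Nat.succ_eq_add_one, Finset.sum_range_two_mul_add_one]
  simp [hf]

/-! ### The generating functions of the Euler and Bernoulli numbers -/

/-- The exponential generating function `∑ E_n s ^ n / n!` of the Euler numbers, that is,
`sech s`. -/
noncomputable def eulerPowerSeries : PowerSeries ℚ :=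
  PowerSeries.mk fun n => eulerNumber n / (n ! : ℚ)

open PowerSeries in
/-- `sech s · 2 cosh s = 2`, obtained from `(cos s)⁻¹ · cos s = 1` by multiplying the coefficient
of `s ^ n` by `(-1) ^ (n / 2)`, for even `n`. -/
theorem eulerPowerSeries_mul_exp_add_exp_neg :
    eulerPowerSeries * (exp ℚ + evalNegHom (exp ℚ)) = 2 := by
  have hcos : (cos ℚ)⁻¹ * cos ℚ = 1 := PowerSeries.inv_mul_cancel _ (by simp [cos])
  have hcosh : ∀ n, coeff n (exp ℚ + evalNegHom (exp ℚ)) = if Even n then 2 / (n ! : ℚ) else 0 := by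
    intro n
    simp only [evalNegHom, map_add, coeff_rescale, coeff_exp]
    split_ifs with h
    · simp [h.neg_one_pow]; ring
    · simp [(Nat.not_even_iff_odd.mp h).neg_one_pow]
  ext n
  have hn := congrArg (coeff n) hcos
  rw [coeff_mul] at hn ⊢
  have h2 : (coeff n) (2 : ℚ⟦X⟧) = if n = 0 then 2 else 0 := by
    rw [← map_ofNat (C (R := ℚ)), coeff_C]
  rw [coeff_one] at hn
  -- In odd degree both sides vanish. In even degree `Even p.2` forces `Even p.1`, so no
  -- information about the odd coefficients of `(cos ℚ)⁻¹` is needed.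
  have key : ∀ p ∈ Finset.HasAntidiagonal.antidiagonal n,
      coeff p.1 eulerPowerSeries * coeff p.2 (exp ℚ + evalNegHom (exp ℚ)) =
      if Even n then
        2 * (-1) ^ (n / 2) * (coeff p.1 (cos ℚ)⁻¹ * coeff p.2 (cos ℚ)) else 0 := by
    rintro ⟨a, b⟩ hab
    obtain rfl : a + b = n := Finset.HasAntidiagonal.mem_antidiagonal.mp hab
    have ha : (a ! : ℚ) ≠ 0 := by positivity
    rw [hcosh]
    simp only [eulerPowerSeries, eulerNumber, cos, coeff_mk, Nat.even_add, Algebra.algebraMap_self,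
      RingHom.id_apply]
    by_cases hb : Even b <;> by_cases hae : Even a <;> simp only [hb, hae, if_true, if_false]
    · obtain ⟨x, rfl⟩ := hb
      obtain ⟨y, rfl⟩ := hae
      rw [show (y + y + (x + x)) / 2 = y + x by omega, show (y + y) / 2 = y by omega,
        show (x + x) / 2 = x by omega, pow_add]
      have hx : ((-1 : ℚ) ^ x) * (-1) ^ x = 1 := by rw [← mul_pow]; simp
      field_simp
      linear_combination (-1) * coeff (y + y) (mk fun n =>
        if Even n then (-1 : ℚ) ^ (n / 2) / (n ! : ℚ) else 0)⁻¹ * hx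
    all_goals simp
  rw [Finset.sum_congr rfl key, h2]
  split_ifs with he h0 h0
  · rw [← Finset.mul_sum, hn]; simp [h0]
  · rw [← Finset.mul_sum, hn]; simp [h0]
  · simp [h0] at he
  · simp

/-- The power series `s tanh s`, written as `4s / (e ^ (4s) - 1) - 2s / (e ^ (2s) - 1) + s`. The last
summand cancels the contribution of `B_1 = -1/2`. -/
noncomputable def xTanhPowerSeries : PowerSeries ℚ :=
  PowerSeries.rescale 4 (bernoulliPowerSeries ℚ) - PowerSeries.rescale 2 (bernoulliPowerSeries ℚ)
    + PowerSeries.X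

open PowerSeries in
theorem coeff_two_mul_xTanhPowerSeries (m : ℕ) :
    coeff (2 * m) xTanhPowerSeries
      = 4 ^ m * ((2 ^ (2 * m) - 1) * bernoulli (2 * m)) / ((2 * m)! : ℚ) := by
  have h1 : 2 * m ≠ 1 := by omega
  simp only [xTanhPowerSeries, bernoulliPowerSeries, map_add, map_sub, coeff_rescale, coeff_mk,
    coeff_X, h1, if_false, Algebra.algebraMap_self, RingHom.id_apply, add_zero]
  rw [pow_mul 4, pow_mul 2, show (4 : ℚ) ^ 2 = 4 * 4 by norm_num, show (2 : ℚ) ^ 2 = 4 by norm_num,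
    mul_pow]
  ring

open PowerSeries in
theorem xTanhPowerSeries_mul_exp_add_exp_neg :
    xTanhPowerSeries * (exp ℚ + evalNegHom (exp ℚ)) = X * (exp ℚ - evalNegHom (exp ℚ)) := by
  have hX : ∀ a : ℚ, rescale a (X : ℚ⟦X⟧) = C a * X := fun a => by
    ext n; simp [coeff_X]
  have h2 := congrArg (rescale (2 : ℚ)) (bernoulliPowerSeries_mul_exp_sub_one ℚ)
  have h4 := congrArg (rescale (4 : ℚ)) (bernoulliPowerSeries_mul_exp_sub_one ℚ)
  have e2 := exp_pow_eq_rescale_exp (A := ℚ) 2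
  have e4 := exp_pow_eq_rescale_exp (A := ℚ) 4
  push_cast at e2 e4
  simp only [map_mul, map_sub, map_one, ← e2, ← e4, hX, map_ofNat] at h2 h4
  have he := exp_mul_exp_neg_eq_one (A := ℚ)
  -- The defining relation of the Bernoulli numbers only yields the claim times `e ^ (2s) - 1`.
  have hne : exp ℚ ^ 2 - 1 ≠ 0 := by
    intro h
    have := congrArg (coeff 1) h
    rw [e2] at this
    simp [coeff_rescale, coeff_exp, coeff_one] at this
  have hexp : exp ℚ ≠ 0 := left_ne_zero_of_mul_eq_one he
  apply mul_left_cancel₀ hne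
  apply mul_left_cancel₀ hexp
  unfold xTanhPowerSeries
  linear_combination (rescale 4 (bernoulliPowerSeries ℚ) -
      rescale 2 (bernoulliPowerSeries ℚ) + X + X) * (exp ℚ ^ 2 - 1) * he + h4 - (exp ℚ ^ 2 + 1) * h2

/-! ### The Bessel polynomial -/

/-- The polynomial `∑_{k ≤ D} binom(2D - k, D) (2s) ^ k / k!`, as a power series; up to
normalization, the reverse Bessel polynomial of degree `D` at `2s`. The bound `k ≤ D` is not
redundant: for `D = 0` the truncated binomial coefficient equals `1` for every `k`. -/
noncomputable def scaledBessel (D : ℕ) : PowerSeries ℚ :=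
  PowerSeries.mk fun k => if k ≤ D then ((2 * D - k).choose D : ℚ) * 2 ^ k / (k ! : ℚ) else 0

open PowerSeries in
theorem xTanhPowerSeries_mul_add_evalNegHom (f : ℚ⟦X⟧) :
    xTanhPowerSeries * (f + evalNegHom f) =
      X * (f - evalNegHom f) +
        eulerPowerSeries *
          (X * (exp ℚ * evalNegHom f - evalNegHom (exp ℚ) * f)) := by
  have h1 := eulerPowerSeries_mul_exp_add_exp_neg
  have h2 := xTanhPowerSeries_mul_exp_add_exp_neg
  have h0 : (2 : ℚ⟦X⟧) ≠ 0 := fun h => by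
    have := congrArg constantCoeff h
    rw [map_ofNat, map_zero] at this
    norm_num at this
  apply mul_left_cancel₀ h0
  linear_combination (X * (f - evalNegHom f) - xTanhPowerSeries * (f + evalNegHom f)) * h1 +
    eulerPowerSeries * (f + evalNegHom f) * h2

open PowerSeries in
/-- The odd coefficients of `e ^ s f(-s)` for the Bessel polynomial `f`. -/
theorem coeff_exp_mul_scaledBessel_neg (D M : ℕ) :
    coeff (2 * M + 1) (exp ℚ * evalNegHom (scaledBessel D)) =
      (-4) ^ D * (M.choose D : ℚ) / ((2 * M + 1)! : ℚ) := by
  rw [← sum_neg_two_pow_mul_choose_mul_choose, mul_comm (exp ℚ), coeff_mul,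
    Finset.Nat.sum_antidiagonal_eq_sum_range_succ
      (fun a b => coeff a (evalNegHom (scaledBessel D)) * coeff b (exp ℚ)), Finset.sum_div]
  refine Finset.sum_congr_of_eq_on_inter ?_ ?_ ?_
  · intro k _ hk
    have : ¬ k ≤ D := by simpa using hk
    simp [evalNegHom, scaledBessel, coeff_rescale, this]
  · intro k _ hk
    rw [Nat.choose_eq_zero_of_lt (by simpa using hk)]
    simp
  · intro k hk hk'
    have h1 : k ≤ 2 * M + 1 := by simpa [Nat.lt_succ_iff] using hk
    have h2 : k ≤ D := by simpa [Nat.lt_succ_iff] using hk'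
    rw [Nat.cast_choose ℚ h1]
    simp only [evalNegHom, scaledBessel, coeff_rescale, coeff_mk, coeff_exp, if_pos h2,
      Algebra.algebraMap_self, RingHom.id_apply]
    have ha : (k ! : ℚ) ≠ 0 := by positivity
    have hb : ((2 * M + 1 - k)! : ℚ) ≠ 0 := by positivity
    have hc : ((2 * M + 1)! : ℚ) ≠ 0 := by positivity
    rw [show (-2 : ℚ) ^ k = (-1) ^ k * 2 ^ k by rw [← mul_pow]; norm_num]
    field_simp

open PowerSeries in
theorem coeff_two_mul_X_mul_exp_mul_scaledBessel_neg_sub (D m : ℕ) :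
    coeff (2 * m) (X * (exp ℚ * evalNegHom (scaledBessel D) -
      evalNegHom (exp ℚ) * scaledBessel D)) =
      (-1) ^ D * 2 ^ (2 * D + 1) * (D + 1) * 2 * (m.choose (D + 1) : ℚ) / ((2 * m)! : ℚ) := by
  have hinv : evalNegHom (exp ℚ) * scaledBessel D =
      evalNegHom (exp ℚ * evalNegHom (scaledBessel D)) := by
    rw [map_mul]
    congr 1
    ext n
    simp [coeff_evalNegHom, ← mul_assoc, ← mul_pow]
  rcases m with _ | m
  · simp
  · rw [hinv, show 2 * (m + 1) = 2 * m + 1 + 1 by ring, coeff_succ_X_mul, map_sub,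
      coeff_evalNegHom, coeff_exp_mul_scaledBessel_neg, Nat.factorial_succ (2 * m + 1),
      show (-4 : ℚ) ^ D = (-1) ^ D * 4 ^ D by rw [← mul_pow]; norm_num,
      Odd.neg_one_pow ⟨m, rfl⟩, pow_succ, pow_mul, show (2 : ℚ) ^ 2 = 4 by norm_num]
    have h : ((m + 1 : ℕ) : ℚ) * (m.choose D : ℚ) =
        ((m + 1).choose (D + 1) : ℚ) * ((D + 1 : ℕ) : ℚ) := by
      exact_mod_cast Nat.add_one_mul_choose_eq m D
    have hf : ((2 * m + 1)! : ℚ) ≠ 0 := by positivity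
    push_cast at h ⊢
    have h0 : (2 * m + 1 + 1 : ℚ) ≠ 0 := by positivity
    field_simp
    linear_combination 4 * h

/-! ### Comparison of coefficients -/

open PowerSeries in
/-- The evaluation of the Bernoulli sum, uniformly in `n ≥ 1` and `d = D + 1`. -/
theorem sum_bernoulli_mul_choose_eq (n D : ℕ) (hn : 1 ≤ n) :
    ∑ j ∈ Finset.range (D / 2 + 1),
      ((2 : ℚ) ^ (2 * n - 2 * j) - 1) * bernoulli (2 * n - 2 * j)
        * ((2 * D - 2 * j).choose D : ℚ) * ((2 * n).choose (2 * j) : ℚ)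
    = (if 2 * n ≤ D + 1 then (n : ℚ) * ((2 * D + 1 - 2 * n).choose D : ℚ) else 0) +
      (-1) ^ D * (2 ^ (2 * D + 1) * (D + 1)) / 4 ^ n *
        ∑ l ∈ Finset.range (n + 1),
          ((n - l).choose (D + 1) : ℚ) * ((2 * n).choose (2 * l) : ℚ) * eulerNumber (2 * l) := by
  set f := scaledBessel D with hf
  have key := congrArg (coeff (2 * n)) (xTanhPowerSeries_mul_add_evalNegHom f)
  rw [mul_comm xTanhPowerSeries, map_add,
    coeff_two_mul_mul_of_odd_coeff_eq_zero (f + evalNegHom f) _ (fun j => by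
      rw [map_add, coeff_evalNegHom, Odd.neg_one_pow ⟨j, rfl⟩]; ring),
    coeff_two_mul_mul_of_odd_coeff_eq_zero eulerPowerSeries _ (fun j => by
      rw [eulerPowerSeries, coeff_mk, eulerNumber, if_neg (by simp), zero_div])] at key
  -- The two ranges differ only in indices with `2 * j > D`, where `coeff (2 * j) f = 0`, or
  -- `j > n`, where `(2 * n).choose (2 * j) = 0`.
  have hleft : ∑ j ∈ Finset.range (n + 1),
        coeff (2 * j) (f + evalNegHom f) * coeff (2 * n - 2 * j) xTanhPowerSeries =
      2 * 4 ^ n / ((2 * n)! : ℚ) * ∑ j ∈ Finset.range (D / 2 + 1),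
      ((2 : ℚ) ^ (2 * n - 2 * j) - 1) * bernoulli (2 * n - 2 * j)
        * ((2 * D - 2 * j).choose D : ℚ) * ((2 * n).choose (2 * j) : ℚ) := by
    rw [Finset.mul_sum]
    refine Finset.sum_congr_of_eq_on_inter ?_ ?_ ?_
    · intro j _ hj
      have : ¬ 2 * j ≤ D := by simp at hj; omega
      simp [hf, coeff_evalNegHom, scaledBessel, this]
    · intro j _ hj
      rw [Nat.choose_eq_zero_of_lt (n := 2 * n) (by simp at hj; omega)]
      simp
    · intro j hj hj'
      have h1 : j ≤ n := by simpa [Nat.lt_succ_iff] using hj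
      have h2 : 2 * j ≤ D := by simp at hj'; omega
      rw [Nat.cast_choose ℚ (show 2 * j ≤ 2 * n by omega), ← Nat.mul_sub,
        coeff_two_mul_xTanhPowerSeries, map_add, coeff_evalNegHom, hf, scaledBessel, coeff_mk,
        if_pos h2, Even.neg_one_pow ⟨j, two_mul j⟩, pow_mul 2 2 j,
        show (2 : ℚ) ^ 2 = 4 by norm_num, show (4 : ℚ) ^ n = 4 ^ j * 4 ^ (n - j) by
          rw [← pow_add, Nat.add_sub_cancel' h1]]
      have ha : ((2 * j)! : ℚ) ≠ 0 := by positivity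
      have hb : ((2 * (n - j))! : ℚ) ≠ 0 := by positivity
      field_simp
      ring
  have hmid : coeff (2 * n) (X * (f - evalNegHom f)) =
      2 * 4 ^ n / ((2 * n)! : ℚ) *
        (if 2 * n ≤ D + 1 then (n : ℚ) * ((2 * D + 1 - 2 * n).choose D : ℚ) else 0) := by
    obtain ⟨m, rfl⟩ : ∃ m, n = m + 1 := ⟨n - 1, by omega⟩
    rw [show 2 * (m + 1) = 2 * m + 1 + 1 by ring, coeff_succ_X_mul, map_sub,
      coeff_evalNegHom, hf, scaledBessel, coeff_mk, Odd.neg_one_pow ⟨m, rfl⟩]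
    by_cases h : 2 * m + 1 ≤ D
    · rw [if_pos h, if_pos (by omega), Nat.factorial_succ (2 * m + 1),
        show 2 * D + 1 - (2 * m + 1 + 1) = 2 * D - (2 * m + 1) by omega, pow_succ 2, pow_mul 2 2 m,
        show (2 : ℚ) ^ 2 = 4 by norm_num, pow_succ]
      have hb : ((2 * m + 1)! : ℚ) ≠ 0 := by positivity
      push_cast
      have h0 : (2 * m + 1 + 1 : ℚ) ≠ 0 := by positivity
      field_simp
      ring
    · rw [if_neg h, if_neg (by omega)]
      ring
  have hright : ∑ l ∈ Finset.range (n + 1), coeff (2 * l) eulerPowerSeries *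
        coeff (2 * n - 2 * l) (X * (exp ℚ * evalNegHom f - evalNegHom (exp ℚ) * f)) =
      2 * 4 ^ n / ((2 * n)! : ℚ) * ((-1) ^ D * (2 ^ (2 * D + 1) * (D + 1)) / 4 ^ n *
        ∑ l ∈ Finset.range (n + 1),
          ((n - l).choose (D + 1) : ℚ) * ((2 * n).choose (2 * l) : ℚ) * eulerNumber (2 * l)) := by
    rw [Finset.mul_sum, Finset.mul_sum]
    refine Finset.sum_congr rfl fun l hl => ?_
    have h1 : l ≤ n := by simpa [Nat.lt_succ_iff] using hl
    rw [Nat.cast_choose ℚ (show 2 * l ≤ 2 * n by omega), ← Nat.mul_sub, hf,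
      coeff_two_mul_X_mul_exp_mul_scaledBessel_neg_sub, eulerPowerSeries, coeff_mk]
    have ha : ((2 * l)! : ℚ) ≠ 0 := by positivity
    have hb : ((2 * (n - l))! : ℚ) ≠ 0 := by positivity
    field_simp
  rw [hleft, hmid, hright, ← mul_add] at key
  exact mul_left_cancel₀ (by positivity) key

theorem theorem3p1 (n d : ℕ) (hn : 1 ≤ n) (hd : 1 ≤ d) :
    (d ≤ n →
      ∑ j ∈ Finset.range ((d - 1) / 2 + 1),
        ((2 : ℚ) ^ (2 * n - 2 * j) - 1) * bernoulli (2 * n - 2 * j) / (2 ^ (2 * d - 1) * (d : ℚ))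
          * ((2 * d - 2 * j - 2).choose (d - 1) : ℚ) * ((2 * n).choose (2 * j) : ℚ)
      = (-1) ^ (d - 1) / 4 ^ n *
          ∑ l ∈ Finset.range (n - d + 1),
            ((n - l).choose d : ℚ) * ((2 * n).choose (2 * l) : ℚ) * eulerNumber (2 * l)) ∧
    (n < d → d < 2 * n →
      ∑ j ∈ Finset.range ((d - 1) / 2 + 1),
        ((2 : ℚ) ^ (2 * n - 2 * j) - 1) * bernoulli (2 * n - 2 * j) / (2 ^ (2 * d - 1) * (d : ℚ))
          * ((2 * d - 2 * j - 2).choose (d - 1) : ℚ) * ((2 * n).choose (2 * j) : ℚ)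
      = 0) ∧
    (2 * n ≤ d →
      ∑ j ∈ Finset.range ((d - 1) / 2 + 1),
        ((2 : ℚ) ^ (2 * n - 2 * j) - 1) * bernoulli (2 * n - 2 * j) / (2 ^ (2 * d - 1) * (d : ℚ))
          * ((2 * d - 2 * j - 2).choose (d - 1) : ℚ) * ((2 * n).choose (2 * j) : ℚ)
      = (n : ℚ) / (2 ^ (2 * d - 1) * (d : ℚ)) * ((2 * d - 2 * n - 1).choose (d - 1) : ℚ)) := by
  obtain ⟨D, rfl⟩ : ∃ D, d = D + 1 := ⟨d - 1, by omega⟩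
  have hS : ∑ j ∈ Finset.range ((D + 1 - 1) / 2 + 1),
        ((2 : ℚ) ^ (2 * n - 2 * j) - 1) * bernoulli (2 * n - 2 * j)
          / (2 ^ (2 * (D + 1) - 1) * ((D + 1 : ℕ) : ℚ))
          * ((2 * (D + 1) - 2 * j - 2).choose (D + 1 - 1) : ℚ) * ((2 * n).choose (2 * j) : ℚ)
      = (if 2 * n ≤ D + 1 then (n : ℚ) / (2 ^ (2 * (D + 1) - 1) * ((D + 1 : ℕ) : ℚ))
          * ((2 * (D + 1) - 2 * n - 1).choose (D + 1 - 1) : ℚ) else 0) +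
        (-1) ^ D / 4 ^ n * ∑ l ∈ Finset.range (n + 1),
          ((n - l).choose (D + 1) : ℚ) * ((2 * n).choose (2 * l) : ℚ) * eulerNumber (2 * l) := by
    have hne : (2 : ℚ) ^ (2 * D + 1) * ((D : ℚ) + 1) ≠ 0 := by positivity
    have h := sum_bernoulli_mul_choose_eq n D hn
    rw [Nat.add_sub_cancel, show 2 * (D + 1) - 1 = 2 * D + 1 by omega,
      show 2 * (D + 1) - 2 * n - 1 = 2 * D + 1 - 2 * n by omega, Nat.cast_succ]
    apply mul_left_cancel₀ hne
    rw [Finset.mul_sum]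
    convert h using 1
    · refine Finset.sum_congr rfl fun j _ => ?_
      rw [show 2 * (D + 1) - 2 * j - 2 = 2 * D - 2 * j by omega]
      field_simp
    · split_ifs
      · field_simp
      · rw [zero_add, zero_add]
        field_simp
  -- The terms with `n - l < d` vanish, so the last sum lives on `l ≤ n - d`.
  refine ⟨fun h => ?_, fun h h' => ?_, fun h => ?_⟩
  · rw [hS, if_neg (by omega), zero_add, Nat.add_sub_cancel]
    congr 1
    refine (Finset.sum_subset (Finset.range_subset_range.mpr (by omega)) fun l hl hl' => ?_).symm
    rw [Nat.choose_eq_zero_of_lt (by simp at hl hl'; omega)]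
    simp
  all_goals
    have hz : ∑ l ∈ Finset.range (n + 1),
        ((n - l).choose (D + 1) : ℚ) * ((2 * n).choose (2 * l) : ℚ) * eulerNumber (2 * l) = 0 :=
      Finset.sum_eq_zero fun l _ => by
        rw [Nat.choose_eq_zero_of_lt (by omega)]
        simp
    rw [hS, hz, mul_zero, add_zero]
  · rw [if_neg (by omega)]
  · rw [if_pos h]
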